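/- For a finite simple graph $G$, a set $D\subseteq V(G)$ is dominating if every vertex outside $D$ is adjacent to a vertex of $D$, and $\gamma(G)$ is the minimum cardinality of a dominating set. For a function $f:V(G)\to V(G)$, the functigraph $C(G,f)$ is the graph formed by two disjoint copies $G_1,G_2$ of $G$ together with the edges joining each vertex $u$ of $G_1$ to the copy of $f(u)$ in $G_2$. Let $C_{3k}$ be the cycle with vertices labeled cyclically $1,2,\dots,3k$. A function $f:\{1,\dots,3k\}\to\{1,\dots,3k\}$ is a three-translate if $f(x+3i)=f(x)+3i$ for all $x\in\{1,2,3\}$ and $i\in\{0,1,\dots,k-1\}$, where the addition is that of integers; such an $f$ maps $\{1,2,3\}$ into itself and is determined by $\tilde f=f|_{\{1,2,3\}}$. For $a_1,a_2,a_3\in\{1,2,3\}$ write $C(C_{3k},(a_1,a_2,a_3))$ for $C(C_{3k},g)$, where $g$ is the three-translate with $g(1)=a_1$, $g(2)=a_2$, $g(3)=a_3$. Theorem. Let $k\ge 3$ and let $f:\{1,\dots,3k\}\to\{1,\dots,3k\}$ be a three-translate which is not a permutation. Then $2\gamma(C_{3k})=2k$, and $\gamma(C(C_{3k},f))=2k$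 if and only if $C(C_{3k},f)$ is isomorphic (as a graph) to $C(C_{3k},(1,1,2))$, to $C(C_{3k},(1,2,1))$, or to $C(C_{3k},(1,3,1))$. -/

import Mathlib

namespace Functigraph

/-- `D` is a dominating set of `G`: every vertex outside `D` is adjacent to some vertex of `D`. -/
def IsDominatingSet {V : Type*} (G : SimpleGraph V) (D : Finset V) : Prop :=
  ∀ v : V, v ∉ D → ∃ u ∈ D, G.Adj u v

/-- The domination number of a finite graph: the minimum cardinality of a dominating set.
(The vertex set is itself dominating, so the set of which the infimum is taken is nonempty.) -/
noncomputable def dominationNumber {V : Type*} [Fintype V] (G : SimpleGraph V) : ℕ :=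
  sInf {m : ℕ | ∃ D : Finset V, IsDominatingSet G D ∧ D.card = m}

/-- The functigraph `C(G, f)`: two disjoint copies of `G` (the domain copy `Sum.inl` and the
codomain copy `Sum.inr`) together with the edges `{u, f u}`, `u` in the domain copy. -/
def functigraph {V : Type*} (G : SimpleGraph V) (f : V → V) : SimpleGraph (V ⊕ V) where
  Adj a b := match a, b with
    | Sum.inl u, Sum.inl v => G.Adj u v
    | Sum.inr u, Sum.inr v => G.Adj u v
    | Sum.inl u, Sum.inr v => v = f u
    | Sum.inr v, Sum.inl u => v = f u
  symm := ⟨by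
    rintro (u | u) (v | v) h
    · exact SimpleGraph.Adj.symm h
    · exact h
    · exact h
    · exact SimpleGraph.Adj.symm h⟩
  loopless := ⟨by
    rintro (u | u) h
    · exact G.loopless.irrefl u h
    · exact G.loopless.irrefl u h⟩

/-- `f` is a three-translate of `{1, …, 3k}`: `f (x + 3i) = f x + 3i` as integers, for
`x ∈ {1, 2, 3}` and `0 ≤ i < k`. The element `j` of `{1, …, 3k}` is the index `j - 1` of
`Fin (3 * k)`, so that `x` and `y = x + 3i` below run through the indices. -/
def IsThreeTranslate (k : ℕ) (f : Fin (3 * k) → Fin (3 * k)) : Prop :=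
  ∀ (x y : Fin (3 * k)) (i : ℕ), (x : ℕ) < 3 → i < k → (y : ℕ) = x + 3 * i →
    (f y : ℕ) = f x + 3 * i

/-- The three-translate of `{1, …, 3k}` with given restriction to `{1, 2, 3}`, in indices starting
from `0`: it maps `r + 3i` to `a r + 3i` for `r = 0, 1, 2` and `0 ≤ i < k`. Thus the three-translate
whose restriction to `{1, 2, 3}` is `(a₁, a₂, a₃)` is `threeTranslate k ![a₁ - 1, a₂ - 1, a₃ - 1]`;
for instance `(1, 1, 2)`, `(1, 2, 1)` and `(1, 3, 1)` are given by `![0, 0, 1]`, `![0, 1, 0]` and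
`![0, 2, 0]`. -/
def threeTranslate (k : ℕ) (a : Fin 3 → Fin 3) (x : Fin (3 * k)) : Fin (3 * k) :=
  ⟨(a ⟨(x : ℕ) % 3, Nat.mod_lt _ (by norm_num)⟩ : ℕ) + 3 * ((x : ℕ) / 3), by omega⟩

end Functigraph

/-! ### Domination numbers, cycles, and the words of three-translates -/

namespace Functigraph

open SimpleGraph

/-! A three-translate is determined by a word of length three and preserves the blocks `{3q, 3q+1,
3q+2}`. Hence every edge between the two copies stays inside a block of six vertices, and whether a
set dominates is a condition on triples of cyclically consecutive blocks. Choosing the middle vertex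
of each block in both copies gives `γ ≤ 2k` for every word.

The 21 non-injective words fall into three kinds. For the constant and the decreasing ones, an
explicit pattern saves a vertex (`dominationNumber_lt`). The six increasing ones all give the graph
of `001`, and the words `aba` give that of `010` or `020` according to `|a - b|`; the isomorphisms
rotate or reflect the two cycles independently.

For these three representatives, `dominationNumber_eq_of_potential` gives `γ ≥ 2k`. A potential on
the states at block boundaries satisfies: weight of a block minus two is at least the increase of
the potential across it. Summed around the cycle, the potential cancels. The inequality itself is a
finite check. -/

theorem dominationNumber_le {V : Type*} [Fintype V] {G : SimpleGraph V} {D : Finset V}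
    (h : IsDominatingSet G D) : dominationNumber G ≤ D.card :=
  Nat.sInf_le ⟨D, h, rfl⟩

theorem le_dominationNumber {V : Type*} [Fintype V] {G : SimpleGraph V} {m : ℕ}
    (h : ∀ D : Finset V, IsDominatingSet G D → m ≤ D.card) : m ≤ dominationNumber G := by
  refine le_csInf ⟨_, Finset.univ, fun v hv => (hv (Finset.mem_univ v)).elim, rfl⟩ ?_
  rintro _ ⟨D, hD, rfl⟩
  exact h D hD

theorem IsDominatingSet.map {V W : Type*} {G : SimpleGraph V} {H : SimpleGraph W} (e : G ≃g H)
    {D : Finset V} (h : IsDominatingSet G D) :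
    IsDominatingSet H (D.map e.toEquiv.toEmbedding) := by
  intro w hw
  obtain ⟨v, rfl⟩ := e.surjective w
  obtain ⟨u, hu, huv⟩ := h v fun hv => hw (Finset.mem_map.2 ⟨v, hv, rfl⟩)
  exact ⟨e u, Finset.mem_map.2 ⟨u, hu, rfl⟩, e.map_adj_iff.2 huv⟩

theorem dominationNumber_le_of_iso {V W : Type*} [Fintype V] [Fintype W] {G : SimpleGraph V}
    {H : SimpleGraph W} (e : G ≃g H) : dominationNumber H ≤ dominationNumber G :=
  le_dominationNumber fun D hD => by
    simpa using dominationNumber_le (hD.map e)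

theorem dominationNumber_congr {V W : Type*} [Fintype V] [Fintype W] {G : SimpleGraph V}
    {H : SimpleGraph W} (e : G ≃g H) : dominationNumber G = dominationNumber H :=
  le_antisymm (dominationNumber_le_of_iso e.symm) (dominationNumber_le_of_iso e)

/-- Adjacency in a cycle of length at least three, without modular arithmetic. -/
theorem cycleGraph_adj_val {n : ℕ} (hn : 3 ≤ n) (u v : Fin n) :
    (cycleGraph n).Adj u v ↔ (v : ℕ) = u + 1 ∨ (u : ℕ) = v + 1 ∨
      ((u : ℕ) = 0 ∧ (v : ℕ) + 1 = n) ∨ ((v : ℕ) = 0 ∧ (u : ℕ) + 1 = n) := by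
  have hu := u.isLt
  have hv := v.isLt
  rw [cycleGraph_adj']
  simp only [Fin.sub_def]
  constructor
  · rintro (h | h)
    · rcases lt_or_ge (n - (v : ℕ) + u) n with h' | h'
      · rw [Nat.mod_eq_of_lt h'] at h; omega
      · rw [Nat.mod_eq_sub_mod h', Nat.mod_eq_of_lt (by omega)] at h; omega
    · rcases lt_or_ge (n - (u : ℕ) + v) n with h' | h'
      · rw [Nat.mod_eq_of_lt h'] at h; omega
      · rw [Nat.mod_eq_sub_mod h', Nat.mod_eq_of_lt (by omega)] at h; omega
  · rintro (h | h | h | h)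
    · right; rw [Nat.mod_eq_sub_mod (by omega), Nat.mod_eq_of_lt (by omega)]; omega
    · left; rw [Nat.mod_eq_sub_mod (by omega), Nat.mod_eq_of_lt (by omega)]; omega
    · left; rw [Nat.mod_eq_of_lt (by omega)]; omega
    · right; rw [Nat.mod_eq_of_lt (by omega)]; omega

theorem dominationNumber_cycleGraph {k : ℕ} (hk : 1 ≤ k) :
    dominationNumber (cycleGraph (3 * k)) = k := by
  apply le_antisymm
  · have hD : IsDominatingSet (cycleGraph (3 * k))
        (Finset.univ.image fun q : Fin k => (⟨3 * q + 1, by omega⟩ : Fin (3 * k))) := by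
      intro v hv
      refine ⟨⟨3 * (v / 3) + 1, by omega⟩,
        Finset.mem_image.2 ⟨⟨v / 3, by omega⟩, Finset.mem_univ _, rfl⟩, ?_⟩
      have h1 : (v : ℕ) ≠ 3 * (v / 3) + 1 := fun h =>
        hv (Finset.mem_image.2 ⟨⟨v / 3, by omega⟩, Finset.mem_univ _, Fin.ext h.symm⟩)
      rw [cycleGraph_adj_val (by omega)]
      dsimp only
      omega
    simpa using (dominationNumber_le hD).trans Finset.card_image_le
  · refine le_dominationNumber fun D hD => ?_
    -- The closed neighbourhood of the middle vertex of a block is that block, so `D` meets every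
    -- block.
    have hsub : Finset.range k ⊆ D.image fun v : Fin (3 * k) => (v : ℕ) / 3 := by
      intro q hq
      have hq := Finset.mem_range.1 hq
      by_cases h : (⟨3 * q + 1, by omega⟩ : Fin (3 * k)) ∈ D
      · exact Finset.mem_image.2 ⟨_, h, by dsimp only; omega⟩
      · obtain ⟨u, hu, huv⟩ := hD _ h
        rw [cycleGraph_adj_val (by omega)] at huv
        dsimp only at huv
        exact Finset.mem_image.2 ⟨u, hu, by omega⟩
    simpa using (Finset.card_le_card hsub).trans Finset.card_image_le

/-- The three-translates are the maps `threeTranslate k a`. -/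
theorem IsThreeTranslate.exists_eq {k : ℕ} (hk : 1 ≤ k) {f : Fin (3 * k) → Fin (3 * k)}
    (hf : IsThreeTranslate k f) : ∃ a, f = threeTranslate k a := by
  -- The translate by the largest shift `3(k - 1)` must still lie below `3k`.
  have hlt (r : Fin 3) : (f ⟨r, by omega⟩ : ℕ) < 3 := by
    have h := hf ⟨r, by omega⟩ ⟨r + 3 * (k - 1), by omega⟩ (k - 1) r.isLt (by omega) rfl
    have := (f ⟨r + 3 * (k - 1), by omega⟩).isLt
    omega
  refine ⟨fun r => ⟨f ⟨r, by omega⟩, hlt r⟩, funext fun y => Fin.ext ?_⟩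
  exact hf ⟨y % 3, by omega⟩ y (y / 3) (Nat.mod_lt _ (by norm_num)) (by omega)
    (Nat.mod_add_div _ _).symm

theorem threeTranslate_bijective {k : ℕ} {a : Fin 3 → Fin 3} (ha : Function.Injective a) :
    Function.Bijective (threeTranslate k a) := by
  rw [← Finite.injective_iff_bijective]
  intro u v h
  have h := congrArg Fin.val h
  simp only [threeTranslate] at h
  have h1 : a ⟨u % 3, Nat.mod_lt _ (by norm_num)⟩ = a ⟨v % 3, Nat.mod_lt _ (by norm_num)⟩ :=
    Fin.ext (by omega)
  have h2 := congrArg Fin.val (ha h1)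
  dsimp only at h2
  exact Fin.ext (by omega)

/-! ### Isomorphisms reducing words to `001`, `010` and `020` -/

/-- Automorphisms of the base graph intertwining `f` and `g` give isomorphic functigraphs. -/
def functigraphIso {V : Type*} {G : SimpleGraph V} {f g : V → V} (σ τ : G ≃g G)
    (h : ∀ x, τ (f x) = g (σ x)) : functigraph G f ≃g functigraph G g where
  toEquiv := Equiv.sumCongr σ.toEquiv τ.toEquiv
  map_rel_iff' := by
    rintro (u | u) (v | v)
    · exact σ.map_adj_iff
    · change τ v = g (σ u) ↔ v = f u
      rw [← h, τ.injective.eq_iff]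
    · change τ u = g (σ v) ↔ u = f v
      rw [← h, τ.injective.eq_iff]
    · exact τ.map_adj_iff

/-- The rotation `x ↦ x + s` of the cycle of length `n`. -/
def cycleRotation {n s : ℕ} (hn : 3 ≤ n) (hs : s < n) : cycleGraph n ≃g cycleGraph n where
  toFun x := ⟨if (x : ℕ) + s < n then x + s else x + s - n, by split_ifs <;> omega⟩
  invFun x := ⟨if s ≤ (x : ℕ) then x - s else x + n - s, by split_ifs <;> omega⟩
  left_inv x := by apply Fin.ext; dsimp only; split_ifs <;> omega
  right_inv x := by apply Fin.ext; dsimp only; split_ifs <;> omega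
  map_rel_iff' := by
    intro u v
    rw [cycleGraph_adj_val hn, cycleGraph_adj_val hn]
    simp only [Equiv.coe_fn_mk]
    split_ifs <;> omega

/-- The reflection `x ↦ s - x` of the cycle of length `n`. -/
def cycleReflection {n s : ℕ} (hn : 3 ≤ n) (hs : s < n) : cycleGraph n ≃g cycleGraph n where
  toFun x := ⟨if (x : ℕ) ≤ s then s - x else s + n - x, by split_ifs <;> omega⟩
  invFun x := ⟨if (x : ℕ) ≤ s then s - x else s + n - x, by split_ifs <;> omega⟩
  left_inv x := by apply Fin.ext; dsimp only; split_ifs <;> omega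
  right_inv x := by apply Fin.ext; dsimp only; split_ifs <;> omega
  map_rel_iff' := by
    intro u v
    rw [cycleGraph_adj_val hn, cycleGraph_adj_val hn]
    simp only [Equiv.coe_fn_mk]
    split_ifs <;> omega

theorem threeTranslate_val {k : ℕ} {a : Fin 3 → Fin 3} (x : Fin (3 * k)) :
    (threeTranslate k a x : ℕ) = (if (x : ℕ) % 3 = 0 then (a 0 : ℕ) else
      if (x : ℕ) % 3 = 1 then (a 1 : ℕ) else a 2) + 3 * (x / 3) := by
  have h : (x : ℕ) % 3 = 0 ∨ (x : ℕ) % 3 = 1 ∨ (x : ℕ) % 3 = 2 := by omega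
  rcases h with h | h | h <;> simp [threeTranslate, h]

/-- In this and the following reductions the two copies are moved by different maps, and the shifts
need not be multiples of three: a fibre may land across the old block boundaries. -/
theorem nonempty_iso_002 {k : ℕ} (hk : 3 ≤ k) :
    Nonempty (functigraph (cycleGraph (3 * k)) (threeTranslate k ![0, 0, 2]) ≃g
      functigraph (cycleGraph (3 * k)) (threeTranslate k ![0, 0, 1])) := by
  refine ⟨functigraphIso (cycleReflection (s := 1) (by omega) (by omega))
    (cycleReflection (s := 0) (by omega) (by omega)) fun x => Fin.ext ?_⟩
  simp [cycleReflection, threeTranslate_val]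
  split_ifs <;> omega

theorem nonempty_iso_011 {k : ℕ} (hk : 3 ≤ k) :
    Nonempty (functigraph (cycleGraph (3 * k)) (threeTranslate k ![0, 1, 1]) ≃g
      functigraph (cycleGraph (3 * k)) (threeTranslate k ![0, 0, 1])) := by
  refine ⟨functigraphIso (cycleReflection (s := 2) (by omega) (by omega))
    (cycleReflection (s := 1) (by omega) (by omega)) fun x => Fin.ext ?_⟩
  simp [cycleReflection, threeTranslate_val]
  split_ifs <;> omega

theorem nonempty_iso_022 {k : ℕ} (hk : 3 ≤ k) :
    Nonempty (functigraph (cycleGraph (3 * k)) (threeTranslate k ![0, 2, 2]) ≃g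
      functigraph (cycleGraph (3 * k)) (threeTranslate k ![0, 0, 1])) := by
  refine ⟨functigraphIso (cycleRotation (s := 2) (by omega) (by omega))
    (cycleRotation (s := 1) (by omega) (by omega)) fun x => Fin.ext ?_⟩
  simp [cycleRotation, threeTranslate_val]
  split_ifs <;> omega

theorem nonempty_iso_101 {k : ℕ} (hk : 3 ≤ k) :
    Nonempty (functigraph (cycleGraph (3 * k)) (threeTranslate k ![1, 0, 1]) ≃g
      functigraph (cycleGraph (3 * k)) (threeTranslate k ![0, 1, 0])) := by
  refine ⟨functigraphIso (cycleReflection (s := 2) (by omega) (by omega))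
    (cycleReflection (s := 1) (by omega) (by omega)) fun x => Fin.ext ?_⟩
  simp [cycleReflection, threeTranslate_val]
  split_ifs <;> omega

theorem nonempty_iso_112 {k : ℕ} (hk : 3 ≤ k) :
    Nonempty (functigraph (cycleGraph (3 * k)) (threeTranslate k ![1, 1, 2]) ≃g
      functigraph (cycleGraph (3 * k)) (threeTranslate k ![0, 0, 1])) := by
  refine ⟨functigraphIso (cycleRotation (s := 0) (by omega) (by omega))
    (cycleRotation (s := 3 * k - 1) (by omega) (by omega)) fun x => Fin.ext ?_⟩
  simp [cycleRotation, threeTranslate_val]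
  split_ifs <;> omega

theorem nonempty_iso_121 {k : ℕ} (hk : 3 ≤ k) :
    Nonempty (functigraph (cycleGraph (3 * k)) (threeTranslate k ![1, 2, 1]) ≃g
      functigraph (cycleGraph (3 * k)) (threeTranslate k ![0, 1, 0])) := by
  refine ⟨functigraphIso (cycleRotation (s := 0) (by omega) (by omega))
    (cycleRotation (s := 3 * k - 1) (by omega) (by omega)) fun x => Fin.ext ?_⟩
  simp [cycleRotation, threeTranslate_val]
  split_ifs <;> omega

theorem nonempty_iso_122 {k : ℕ} (hk : 3 ≤ k) :
    Nonempty (functigraph (cycleGraph (3 * k)) (threeTranslate k ![1, 2, 2]) ≃g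
      functigraph (cycleGraph (3 * k)) (threeTranslate k ![0, 0, 1])) := by
  refine ⟨functigraphIso (cycleReflection (s := 2) (by omega) (by omega))
    (cycleReflection (s := 2) (by omega) (by omega)) fun x => Fin.ext ?_⟩
  simp [cycleReflection, threeTranslate_val]
  split_ifs <;> omega

theorem nonempty_iso_202 {k : ℕ} (hk : 3 ≤ k) :
    Nonempty (functigraph (cycleGraph (3 * k)) (threeTranslate k ![2, 0, 2]) ≃g
      functigraph (cycleGraph (3 * k)) (threeTranslate k ![0, 2, 0])) := by
  refine ⟨functigraphIso (cycleReflection (s := 2) (by omega) (by omega))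
    (cycleReflection (s := 2) (by omega) (by omega)) fun x => Fin.ext ?_⟩
  simp [cycleReflection, threeTranslate_val]
  split_ifs <;> omega

theorem nonempty_iso_212 {k : ℕ} (hk : 3 ≤ k) :
    Nonempty (functigraph (cycleGraph (3 * k)) (threeTranslate k ![2, 1, 2]) ≃g
      functigraph (cycleGraph (3 * k)) (threeTranslate k ![0, 1, 0])) := by
  refine ⟨functigraphIso (cycleReflection (s := 2) (by omega) (by omega))
    (cycleReflection (s := 2) (by omega) (by omega)) fun x => Fin.ext ?_⟩
  simp [cycleReflection, threeTranslate_val]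
  split_ifs <;> omega

end Functigraph

/-! ### Encoding sets of vertices by cyclic sequences of blocks -/

namespace Functigraph

open SimpleGraph

/-- The vertex `i mod 3k` of the cycle of length `3k`. -/
def vertex {k : ℕ} (hk : 1 ≤ k) (i : ℕ) : Fin (3 * k) := ⟨i % (3 * k), Nat.mod_lt _ (by omega)⟩

/-- Membership bits of a block of three consecutive vertices, in the domain copy and in the
codomain copy. -/
abbrev Block := (Fin 3 → Bool) × (Fin 3 → Bool)

/-- The number of chosen vertices of a block. -/
def Block.weight (b : Block) : ℕ := ∑ r, (b.1 r).toNat + ∑ r, (b.2 r).toNat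

/-- The bits of the set `D` in the block with index `q mod k`. -/
def bits {k : ℕ} (hk : 1 ≤ k) (D : Finset (Fin (3 * k) ⊕ Fin (3 * k))) (q : ℕ) : Block :=
  (fun r => decide (Sum.inl (vertex hk (3 * q + r)) ∈ D),
    fun r => decide (Sum.inr (vertex hk (3 * q + r)) ∈ D))

/-- The six vertices of the block `b` are dominated, where `u` and `v` are the preceding and the
following block. -/
def BlockDominated (a : Fin 3 → Fin 3) (u b v : Block) : Prop :=
  (b.1 0 || u.1 2 || b.1 1 || b.2 (a 0)) = true ∧
  (b.1 1 || b.1 0 || b.1 2 || b.2 (a 1)) = true ∧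
  (b.1 2 || b.1 1 || v.1 0 || b.2 (a 2)) = true ∧
  (b.2 0 || u.2 2 || b.2 1 || decide (∃ r, a r = 0 ∧ b.1 r = true)) = true ∧
  (b.2 1 || b.2 0 || b.2 2 || decide (∃ r, a r = 1 ∧ b.1 r = true)) = true ∧
  (b.2 2 || b.2 1 || v.2 0 || decide (∃ r, a r = 2 ∧ b.1 r = true)) = true

instance (a : Fin 3 → Fin 3) (u b v : Block) : Decidable (BlockDominated a u b v) := by
  unfold BlockDominated; infer_instance

theorem exists_vertex {k : ℕ} (hk : 1 ≤ k) (v : Fin (3 * k)) :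
    ∃ q < k, ∃ r : Fin 3, v = vertex hk (3 * q + r) := by
  refine ⟨v / 3, by omega, ⟨v % 3, Nat.mod_lt _ (by norm_num)⟩, Fin.ext ?_⟩
  have : (v : ℕ) % (3 * k) = v := Nat.mod_eq_of_lt v.isLt
  simp only [vertex, Nat.div_add_mod, this]

theorem vertex_add {k : ℕ} (hk : 1 ≤ k) (i : ℕ) : vertex hk (i + 3 * k) = vertex hk i := by
  simp [vertex]

/-- The predecessor is written `i + (3k - 1)`, which avoids truncated subtraction at `i = 0`. -/
theorem adj_vertex_iff {k : ℕ} (hk : 1 ≤ k) {i : ℕ} (u : Fin (3 * k)) :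
    (cycleGraph (3 * k)).Adj u (vertex hk i) ↔
      u = vertex hk (i + 1) ∨ u = vertex hk (i + (3 * k - 1)) := by
  have hi : i % (3 * k) < 3 * k := Nat.mod_lt _ (by omega)
  have h1 : (i + 1) % (3 * k) = if i % (3 * k) + 1 < 3 * k then i % (3 * k) + 1 else 0 := by
    rw [Nat.add_mod, Nat.mod_eq_of_lt (show 1 < 3 * k by omega)]
    split_ifs with h
    · exact Nat.mod_eq_of_lt h
    · rw [show i % (3 * k) + 1 = 3 * k by omega, Nat.mod_self]
  have h2 : (i + (3 * k - 1)) % (3 * k) =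
      if i % (3 * k) = 0 then 3 * k - 1 else i % (3 * k) - 1 := by
    rw [Nat.add_mod, Nat.mod_eq_of_lt (show 3 * k - 1 < 3 * k by omega)]
    split_ifs with h
    · rw [h, Nat.zero_add]; exact Nat.mod_eq_of_lt (by omega)
    · rw [Nat.mod_eq_sub_mod (by omega), Nat.mod_eq_of_lt (by omega)]; omega
  have hu := u.isLt
  rw [cycleGraph_adj_val (by omega), Fin.ext_iff, Fin.ext_iff]
  simp only [vertex, h1, h2]
  generalize i % (3 * k) = j at *
  split_ifs <;> omega

theorem threeTranslate_vertex {k : ℕ} (hk : 1 ≤ k) (a : Fin 3 → Fin 3) {q : ℕ} (hq : q < k)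
    (r : Fin 3) : threeTranslate k a (vertex hk (3 * q + r)) = vertex hk (3 * q + a r) := by
  have h1 : (3 * q + (r : ℕ)) % (3 * k) = 3 * q + r := Nat.mod_eq_of_lt (by omega)
  have h2 : (3 * q + (a r : ℕ)) % (3 * k) = 3 * q + a r := Nat.mod_eq_of_lt (by omega)
  have h3 : (⟨(3 * q + (r : ℕ)) % 3, Nat.mod_lt _ (by norm_num)⟩ : Fin 3) = r :=
    Fin.ext (by dsimp only; omega)
  apply Fin.ext
  simp only [threeTranslate, vertex, h1, h2, h3]
  omega

theorem vertex_inj {k : ℕ} (hk : 1 ≤ k) {q q' : ℕ} (hq : q < k) (hq' : q' < k) {r r' : Fin 3} :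
    vertex hk (3 * q + r) = vertex hk (3 * q' + r') ↔ q = q' ∧ r = r' := by
  have h1 : (3 * q + (r : ℕ)) % (3 * k) = 3 * q + r := Nat.mod_eq_of_lt (by omega)
  have h2 : (3 * q' + (r' : ℕ)) % (3 * k) = 3 * q' + r' := Nat.mod_eq_of_lt (by omega)
  simp only [vertex, Fin.ext_iff, h1, h2]
  omega

theorem dominated_iff {V : Type*} {G : SimpleGraph V} {D : Finset V} {v : V} :
    (v ∉ D → ∃ u ∈ D, G.Adj u v) ↔ v ∈ D ∨ ∃ u ∈ D, G.Adj u v := by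
  tauto

theorem dominated_inl_iff {k : ℕ} (hk : 1 ≤ k) (a : Fin 3 → Fin 3)
    (D : Finset (Fin (3 * k) ⊕ Fin (3 * k))) {q : ℕ} (hq : q < k) (r : Fin 3) :
    (Sum.inl (vertex hk (3 * q + r)) ∉ D → ∃ u ∈ D, (functigraph (cycleGraph (3 * k))
      (threeTranslate k a)).Adj u (Sum.inl (vertex hk (3 * q + r)))) ↔
    Sum.inl (vertex hk (3 * q + r)) ∈ D ∨ Sum.inl (vertex hk (3 * q + r + (3 * k - 1))) ∈ D ∨
      Sum.inl (vertex hk (3 * q + r + 1)) ∈ D ∨ Sum.inr (vertex hk (3 * q + a r)) ∈ D := by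
  rw [dominated_iff]
  simp only [Sum.exists, functigraph, adj_vertex_iff, threeTranslate_vertex hk a hq,
    exists_eq_right, and_or_left, exists_or]
  tauto

theorem dominated_inr_iff {k : ℕ} (hk : 1 ≤ k) (a : Fin 3 → Fin 3)
    (D : Finset (Fin (3 * k) ⊕ Fin (3 * k))) {q : ℕ} (hq : q < k) (j : Fin 3) :
    (Sum.inr (vertex hk (3 * q + j)) ∉ D → ∃ u ∈ D, (functigraph (cycleGraph (3 * k))
      (threeTranslate k a)).Adj u (Sum.inr (vertex hk (3 * q + j)))) ↔
    Sum.inr (vertex hk (3 * q + j)) ∈ D ∨ Sum.inr (vertex hk (3 * q + j + (3 * k - 1))) ∈ D ∨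
      Sum.inr (vertex hk (3 * q + j + 1)) ∈ D ∨
      ∃ r, a r = j ∧ Sum.inl (vertex hk (3 * q + r)) ∈ D := by
  -- All preimages of a codomain vertex lie in its own block.
  have key : (∃ u, Sum.inl u ∈ D ∧ vertex hk (3 * q + j) = threeTranslate k a u) ↔
      ∃ r, a r = j ∧ Sum.inl (vertex hk (3 * q + r)) ∈ D := by
    constructor
    · rintro ⟨u, hu, h⟩
      obtain ⟨q', hq', r, rfl⟩ := exists_vertex hk u
      rw [threeTranslate_vertex hk a hq', vertex_inj hk hq hq'] at h
      exact ⟨r, h.2.symm, h.1 ▸ hu⟩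
    · rintro ⟨r, rfl, h⟩
      exact ⟨_, h, (threeTranslate_vertex hk a hq r).symm⟩
  rw [dominated_iff]
  simp only [Sum.exists, functigraph, adj_vertex_iff, key, exists_eq_right, and_or_left, exists_or]
  generalize (∃ r, a r = j ∧ Sum.inl (vertex hk (3 * q + r)) ∈ D) = P
  tauto

/-- Only the cycle edges between a last and a first vertex leave a block, so the two neighbouring
blocks suffice. The preceding block has index `q + (k - 1)` modulo `k`. -/
theorem isDominatingSet_iff {k : ℕ} (hk : 1 ≤ k) (a : Fin 3 → Fin 3)
    (D : Finset (Fin (3 * k) ⊕ Fin (3 * k))) :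
    IsDominatingSet (functigraph (cycleGraph (3 * k)) (threeTranslate k a)) D ↔
      ∀ q < k, BlockDominated a (bits hk D (q + (k - 1))) (bits hk D q) (bits hk D (q + 1)) := by
  have h1 : IsDominatingSet (functigraph (cycleGraph (3 * k)) (threeTranslate k a)) D ↔
      ∀ q < k, (∀ r : Fin 3, Sum.inl (vertex hk (3 * q + r)) ∉ D → ∃ u ∈ D,
        (functigraph (cycleGraph (3 * k)) (threeTranslate k a)).Adj u
          (Sum.inl (vertex hk (3 * q + r)))) ∧
        (∀ r : Fin 3, Sum.inr (vertex hk (3 * q + r)) ∉ D → ∃ u ∈ D,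
        (functigraph (cycleGraph (3 * k)) (threeTranslate k a)).Adj u
          (Sum.inr (vertex hk (3 * q + r)))) := by
    refine ⟨fun h q _ => ⟨fun r => h _, fun r => h _⟩, fun h => ?_⟩
    rintro (v | v) <;> obtain ⟨q, hq, r, rfl⟩ := exists_vertex hk v
    · exact (h q hq).1 r
    · exact (h q hq).2 r
  rw [h1]
  refine forall₂_congr fun q hq => ?_
  have e1 : 3 * (q + (k - 1)) + 2 = 3 * q + (3 * k - 1) := by omega
  have e2 : 3 * q + 1 + (3 * k - 1) = 3 * q + 3 * k := by omega
  have e3 : 3 * q + 2 + (3 * k - 1) = 3 * q + 1 + 3 * k := by omega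
  have e4 : 3 * (q + 1) = 3 * q + 2 + 1 := by omega
  simp only [dominated_inl_iff hk a D hq, dominated_inr_iff hk a D hq]
  simp only [Fin.forall_fin_succ, BlockDominated, bits, Bool.or_eq_true, decide_eq_true_eq,
    Fin.val_zero, Fin.val_one, Fin.val_two, e1, e4, Nat.add_zero]
  simp [e2, e3, vertex_add, or_assoc, and_assoc]

theorem bits_add {k : ℕ} (hk : 1 ≤ k) (D : Finset (Fin (3 * k) ⊕ Fin (3 * k))) (q : ℕ) :
    bits hk D (q + k) = bits hk D q := by
  have (r : ℕ) : vertex hk (3 * (q + k) + r) = vertex hk (3 * q + r) := by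
    rw [← vertex_add hk (3 * q + r)]
    congr 1
    ring
  simp only [bits, this]

theorem sum_range_three_mul (g : ℕ → ℕ) (k : ℕ) :
    ∑ i ∈ Finset.range (3 * k), g i = ∑ q ∈ Finset.range k, ∑ r : Fin 3, g (3 * q + r) := by
  induction k with
  | zero => simp
  | succ k ih =>
    rw [Finset.sum_range_succ, ← ih, Fin.sum_univ_three, Nat.mul_succ, Finset.sum_range_succ,
      Finset.sum_range_succ, Finset.sum_range_succ]
    simp [add_assoc]

theorem sum_fin_three_mul {k : ℕ} (hk : 1 ≤ k) (g : Fin (3 * k) → ℕ) :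
    ∑ v, g v = ∑ q ∈ Finset.range k, ∑ r : Fin 3, g (vertex hk (3 * q + r)) := by
  rw [← sum_range_three_mul fun i => g (vertex hk i), ← Fin.sum_univ_eq_sum_range]
  refine Finset.sum_congr rfl fun v _ => congrArg g (Fin.ext ?_)
  exact (Nat.mod_eq_of_lt v.isLt).symm

theorem card_eq_sum_weight {k : ℕ} (hk : 1 ≤ k) (D : Finset (Fin (3 * k) ⊕ Fin (3 * k))) :
    D.card = ∑ q ∈ Finset.range k, (bits hk D q).weight := by
  have h : D.card = ∑ v, (decide (v ∈ D)).toNat := by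
    rw [Finset.card_eq_sum_ones, ← Finset.sum_subset (Finset.subset_univ D)]
    · exact Finset.sum_congr rfl fun v hv => by simp [hv]
    · exact fun v _ hv => by simp [hv]
  rw [h, Fintype.sum_sum_type, sum_fin_three_mul hk, sum_fin_three_mul hk,
    ← Finset.sum_add_distrib]
  rfl

/-- The set with prescribed blocks. -/
def ofBlocks (k : ℕ) (p : ℕ → Block) : Finset (Fin (3 * k) ⊕ Fin (3 * k)) :=
  Finset.univ.filter fun v => Sum.elim
    (fun v : Fin (3 * k) => (p (v / 3)).1 ⟨v % 3, Nat.mod_lt _ (by norm_num)⟩)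
    (fun v : Fin (3 * k) => (p (v / 3)).2 ⟨v % 3, Nat.mod_lt _ (by norm_num)⟩) v = true

theorem bits_ofBlocks {k : ℕ} (hk : 1 ≤ k) (p : ℕ → Block) {q : ℕ} (hq : q < k) :
    bits hk (ofBlocks k p) q = p q := by
  have h1 (r : Fin 3) : (3 * q + (r : ℕ)) % (3 * k) = 3 * q + r := Nat.mod_eq_of_lt (by omega)
  have h2 (r : Fin 3) : (3 * q + (r : ℕ)) / 3 = q := by omega
  have h3 (r : Fin 3) : (⟨(r : ℕ) % 3, Nat.mod_lt _ (by norm_num)⟩ : Fin 3) = r :=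
    Fin.ext (Nat.mod_eq_of_lt r.isLt)
  ext r <;> simp [bits, ofBlocks, vertex, h1, h2, h3]

/-- Only the values of `p` below `k` matter; the first and last blocks, where the sequence wraps
around, have their own hypotheses. The index `1 % k` covers `k = 1`. -/
theorem dominationNumber_le_sum_weight {k : ℕ} (hk : 1 ≤ k) {a : Fin 3 → Fin 3} (p : ℕ → Block)
    (h0 : BlockDominated a (p (k - 1)) (p 0) (p (1 % k)))
    (h : ∀ q, q + 2 < k → BlockDominated a (p q) (p (q + 1)) (p (q + 2)))
    (h1 : 2 ≤ k → BlockDominated a (p (k - 2)) (p (k - 1)) (p 0)) :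
    dominationNumber (functigraph (cycleGraph (3 * k)) (threeTranslate k a)) ≤
      ∑ q ∈ Finset.range k, (p q).weight := by
  have hmod (q : ℕ) : bits hk (ofBlocks k p) q = p (q % k) := by
    induction q using Nat.strong_induction_on with
    | _ q ih =>
      rcases lt_or_ge q k with hq | hq
      · rw [bits_ofBlocks hk p hq, Nat.mod_eq_of_lt hq]
      · obtain ⟨q, rfl⟩ := Nat.exists_eq_add_of_le' hq
        rw [bits_add, ih q (by omega), Nat.add_mod_right]
  have hD : IsDominatingSet (functigraph (cycleGraph (3 * k)) (threeTranslate k a))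
      (ofBlocks k p) := by
    rw [isDominatingSet_iff hk]
    intro q hq
    simp only [hmod]
    rcases q with _ | q
    · simpa [Nat.mod_eq_of_lt (show k - 1 < k by omega)] using h0
    · rw [show q + 1 + (k - 1) = q + k by omega, Nat.add_mod_right, Nat.mod_eq_of_lt hq,
        Nat.mod_eq_of_lt (show q < k by omega)]
      rcases lt_or_ge (q + 2) k with h2 | h2
      · rw [Nat.mod_eq_of_lt h2]; exact h q h2
      · obtain rfl : k = q + 2 := by omega
        rw [Nat.mod_self]; exact h1 (by omega)
  refine (dominationNumber_le hD).trans_eq ?_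
  rw [card_eq_sum_weight hk]
  exact Finset.sum_congr rfl fun q hq => by rw [bits_ofBlocks hk p (Finset.mem_range.1 hq)]

end Functigraph

/-! ### Upper bounds from explicit patterns -/

namespace Functigraph

open SimpleGraph

/-- A pattern that is periodic except for two blocks of total weight three. -/
theorem dominationNumber_lt {k : ℕ} (hk : 3 ≤ k) {a : Fin 3 → Fin 3} (s t p : Block)
    (h : (BlockDominated a p s t ∧ BlockDominated a s t p ∧ BlockDominated a t p p ∧
      BlockDominated a p p p ∧ BlockDominated a p p s ∧ BlockDominated a t p s) ∧
      s.weight + t.weight ≤ 3 ∧ p.weight ≤ 2) :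
    dominationNumber (functigraph (cycleGraph (3 * k)) (threeTranslate k a)) < 2 * k := by
  obtain ⟨⟨h1, h2, h3, h4, h5, h6⟩, h7, h8⟩ := h
  obtain ⟨k, rfl⟩ := Nat.exists_eq_add_of_le' hk
  let c : ℕ → Block
    | 0 => s
    | 1 => t
    | _ + 2 => p
  refine (dominationNumber_le_sum_weight (by omega) c ?_ ?_ ?_).trans_lt ?_
  · rw [Nat.mod_eq_of_lt (by omega)]
    exact h1
  · rintro (_ | _ | q) _
    exacts [h2, h3, h4]
  · intro _
    -- With three blocks in all, the block before the last is `t` rather than `p`.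
    rcases k with _ | k
    exacts [h6, h5]
  · rw [Finset.sum_range_succ', Finset.sum_range_succ']
    -- Here the cycle has `k + 3` blocks, and the total is at most `2(k + 1) + 3 < 2(k + 3)`.
    have : ∑ q ∈ Finset.range (k + 1), (c (q + 1 + 1)).weight ≤ (k + 1) * 2 := by
      refine (Finset.sum_le_card_nsmul _ _ 2 fun q _ => h8).trans_eq ?_
      rw [Finset.card_range, smul_eq_mul]
    change _ + t.weight + s.weight < _
    omega

theorem dominationNumber_le_two_mul {k : ℕ} (hk : 3 ≤ k) (a : Fin 3 → Fin 3) :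
    dominationNumber (functigraph (cycleGraph (3 * k)) (threeTranslate k a)) ≤ 2 * k := by
  have h : BlockDominated a (![false, true, false], ![false, true, false])
      (![false, true, false], ![false, true, false])
      (![false, true, false], ![false, true, false]) := by
    simp [BlockDominated]
  refine (dominationNumber_le_sum_weight (by omega)
    (fun _ => (![false, true, false], ![false, true, false])) h (fun _ _ => h)
    (fun _ => h)).trans_eq ?_
  rw [Finset.sum_const, Finset.card_range, smul_eq_mul, mul_comm]
  rfl

/-- For each decreasing word, one exceptional block contains a single chosen vertex, the codomain
vertex with two preimages. The third domain vertex of that block is dominated by the domain vertex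
chosen in a neighbouring block. -/
theorem dominationNumber_100_lt {k : ℕ} (hk : 3 ≤ k) :
    dominationNumber (functigraph (cycleGraph (3 * k)) (threeTranslate k ![1, 0, 0])) <
      2 * k :=
  dominationNumber_lt hk (![false, false, false], ![true, false, false])
    (![false, false, false], ![true, true, false])
    (![false, false, true], ![false, true, false]) (by decide)

theorem dominationNumber_110_lt {k : ℕ} (hk : 3 ≤ k) :
    dominationNumber (functigraph (cycleGraph (3 * k)) (threeTranslate k ![1, 1, 0])) <
      2 * k :=
  dominationNumber_lt hk (![false, false, false], ![true, true, false])
    (![false, false, false], ![false, true, false])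
    (![true, false, false], ![true, false, false]) (by decide)

theorem dominationNumber_200_lt {k : ℕ} (hk : 3 ≤ k) :
    dominationNumber (functigraph (cycleGraph (3 * k)) (threeTranslate k ![2, 0, 0])) <
      2 * k :=
  dominationNumber_lt hk (![false, false, true], ![false, false, true])
    (![false, false, false], ![true, false, false])
    (![true, false, false], ![true, false, false]) (by decide)

theorem dominationNumber_211_lt {k : ℕ} (hk : 3 ≤ k) :
    dominationNumber (functigraph (cycleGraph (3 * k)) (threeTranslate k ![2, 1, 1])) <
      2 * k :=
  dominationNumber_lt hk (![false, false, false], ![false, true, false])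
    (![false, false, false], ![false, true, true])
    (![false, false, true], ![false, false, true]) (by decide)

theorem dominationNumber_220_lt {k : ℕ} (hk : 3 ≤ k) :
    dominationNumber (functigraph (cycleGraph (3 * k)) (threeTranslate k ![2, 2, 0])) <
      2 * k :=
  dominationNumber_lt hk (![false, false, true], ![false, false, true])
    (![false, false, false], ![false, false, true])
    (![true, false, false], ![true, false, false]) (by decide)

theorem dominationNumber_221_lt {k : ℕ} (hk : 3 ≤ k) :
    dominationNumber (functigraph (cycleGraph (3 * k)) (threeTranslate k ![2, 2, 1])) <
      2 * k :=
  dominationNumber_lt hk (![false, false, false], ![false, true, true])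
    (![false, false, false], ![false, false, true])
    (![true, false, false], ![false, true, false]) (by decide)

/-- For a constant word the image vertex of each block already dominates: it is joined to the whole
domain block, and the images are three apart on the codomain cycle. The second vertex in `p` is
superfluous. -/
theorem dominationNumber_000_lt {k : ℕ} (hk : 3 ≤ k) :
    dominationNumber (functigraph (cycleGraph (3 * k)) (threeTranslate k ![0, 0, 0])) <
      2 * k :=
  dominationNumber_lt hk (![false, false, false], ![true, false, false])
    (![false, false, false], ![true, false, false])
    (![false, false, false], ![true, true, false]) (by decide)

theorem dominationNumber_111_lt {k : ℕ} (hk : 3 ≤ k) :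
    dominationNumber (functigraph (cycleGraph (3 * k)) (threeTranslate k ![1, 1, 1])) <
      2 * k :=
  dominationNumber_lt hk (![false, false, false], ![false, true, false])
    (![false, false, false], ![false, true, false])
    (![false, false, false], ![false, true, true]) (by decide)

theorem dominationNumber_222_lt {k : ℕ} (hk : 3 ≤ k) :
    dominationNumber (functigraph (cycleGraph (3 * k)) (threeTranslate k ![2, 2, 2])) <
      2 * k :=
  dominationNumber_lt hk (![false, false, false], ![false, false, true])
    (![false, false, false], ![false, false, true])
    (![false, false, false], ![true, false, true]) (by decide)

/-! ### Lower bounds from potentials -/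

/-- The value of a potential at the boundary following the block `b`. Its arguments tell for the
last vertex of each copy whether it is chosen, and whether it is dominated from within the block. -/
def boundary (a : Fin 3 → Fin 3) (φ : Bool → Bool → Bool → Bool → ℕ) (b : Block) : ℕ :=
  φ (b.1 2) (b.1 2 || b.1 1 || b.2 (a 2)) (b.2 2)
    (b.2 2 || b.2 1 || decide (∃ r, a r = 2 ∧ b.1 r = true))

/-- Passing a dominated block `b` raises the potential `φ` by at most the weight of `b` minus two. -/
def PotentialStep (a : Fin 3 → Fin 3) (φ : Bool → Bool → Bool → Bool → ℕ) (x x' y y' : Bool)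
    (b : Block) : Prop :=
  (x' || b.1 0) = true → (y' || b.2 0) = true →
  (b.1 0 || x || b.1 1 || b.2 (a 0)) = true →
  (b.1 1 || b.1 0 || b.1 2 || b.2 (a 1)) = true →
  (b.2 0 || y || b.2 1 || decide (∃ r, a r = 0 ∧ b.1 r = true)) = true →
  (b.2 1 || b.2 0 || b.2 2 || decide (∃ r, a r = 1 ∧ b.1 r = true)) = true →
  2 + boundary a φ b ≤ b.weight + φ x x' y y'

instance (a : Fin 3 → Fin 3) (φ : Bool → Bool → Bool → Bool → ℕ) (x x' y y' : Bool) (b : Block) :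
    Decidable (PotentialStep a φ x x' y y' b) := by
  unfold PotentialStep; infer_instance

/-- Summing the step inequality over all blocks cancels the boundary terms and leaves `2k ≤ |D|`.
Each step uses the domination of the last vertices of the preceding block and of the first and
middle vertices of the current one; the current last vertices wait for the next step. -/
theorem dominationNumber_eq_of_potential {k : ℕ} (hk : 3 ≤ k) {a : Fin 3 → Fin 3}
    (φ : Bool → Bool → Bool → Bool → ℕ)
    (hφ : ∀ x x' y y' x₀ x₁ x₂ y₀ y₁ y₂ : Bool, (x = true → x' = true) → (y = true → y' = true) →
      PotentialStep a φ x x' y y' (![x₀, x₁, x₂], ![y₀, y₁, y₂])) :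
    dominationNumber (functigraph (cycleGraph (3 * k)) (threeTranslate k a)) = 2 * k := by
  refine le_antisymm (dominationNumber_le_two_mul hk a) (le_dominationNumber fun D hD => ?_)
  have hk1 : 1 ≤ k := by omega
  rw [isDominatingSet_iff hk1] at hD
  have hstep : ∀ q < k, 2 + boundary a φ (bits hk1 D q) ≤
      (bits hk1 D q).weight + boundary a φ (bits hk1 D (q + (k - 1))) := by
    intro q hq
    have hcur := hD q hq
    have hprev : BlockDominated a (bits hk1 D (q + (k - 1) + (k - 1)))
        (bits hk1 D (q + (k - 1))) (bits hk1 D q) := by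
      rcases q with _ | q
      · have := hD (k - 1) (by omega)
        rw [show k - 1 + 1 = 0 + k by omega, bits_add] at this
        simpa using this
      · have := hD q (by omega)
        rwa [show q + 1 + (k - 1) = q + k by omega, bits_add,
          show q + k + (k - 1) = q + (k - 1) + k by omega, bits_add]
    generalize bits hk1 D (q + (k - 1)) = u at *
    generalize bits hk1 D q = b at *
    obtain ⟨-, -, p1, -, -, p2⟩ := hprev
    obtain ⟨c1, c2, -, c3, c4, -⟩ := hcur
    have hb : b = (![b.1 0, b.1 1, b.1 2], ![b.2 0, b.2 1, b.2 2]) := by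
      ext r <;> fin_cases r <;> rfl
    have key := hφ (u.1 2) (u.1 2 || u.1 1 || u.2 (a 2)) (u.2 2)
      (u.2 2 || u.2 1 || decide (∃ r, a r = 2 ∧ u.1 r = true)) (b.1 0) (b.1 1) (b.1 2)
      (b.2 0) (b.2 1) (b.2 2) (fun h => by simp [h]) (fun h => by simp [h])
    rw [← hb] at key
    refine key ?_ ?_ c1 c2 c3 c4
    · rwa [Bool.or_right_comm]
    · rwa [Bool.or_right_comm]
  have hsum := Finset.sum_le_sum fun q hq => hstep q (Finset.mem_range.1 hq)
  -- Passing to the preceding block permutes the blocks cyclically.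
  have hshift : ∑ q ∈ Finset.range k, boundary a φ (bits hk1 D (q + (k - 1))) =
      ∑ q ∈ Finset.range k, boundary a φ (bits hk1 D q) := by
    obtain ⟨k, rfl⟩ := Nat.exists_eq_add_of_le' hk1
    rw [Finset.sum_range_succ', Finset.sum_range_succ]
    congr 1
    · refine Finset.sum_congr rfl fun q _ => ?_
      rw [show q + 1 + (k + 1 - 1) = q + (k + 1) by omega, bits_add]
    · simp
  rw [Finset.sum_add_distrib, Finset.sum_add_distrib, hshift, ← card_eq_sum_weight] at hsum
  simp only [Finset.sum_const, Finset.card_range, smul_eq_mul] at hsum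
  omega

/-- Here and below, the potential bounds how many vertices the blocks after a boundary can save
against two per block: at most two for `001`, at most one for `010` and `020`. -/
theorem dominationNumber_001 {k : ℕ} (hk : 3 ≤ k) :
    dominationNumber (functigraph (cycleGraph (3 * k)) (threeTranslate k ![0, 0, 1])) = 2 * k :=
  dominationNumber_eq_of_potential hk
    (fun x x' y y' => (x' || y').toNat + (y' && (x || !x' && !y)).toNat) (by decide +kernel)

/-- The clause `!x' && !y'`, here and for `020`, concerns a state that no dominated block leaves:
the middle codomain vertex would be undominated. -/
theorem dominationNumber_010 {k : ℕ} (hk : 3 ≤ k) :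
    dominationNumber (functigraph (cycleGraph (3 * k)) (threeTranslate k ![0, 1, 0])) = 2 * k :=
  dominationNumber_eq_of_potential hk
    (fun x x' y y' => (!x' && !y' || x' && y || x && y').toNat) (by decide +kernel)

theorem dominationNumber_020 {k : ℕ} (hk : 3 ≤ k) :
    dominationNumber (functigraph (cycleGraph (3 * k)) (threeTranslate k ![0, 2, 0])) = 2 * k :=
  dominationNumber_eq_of_potential hk
    (fun x x' y y' => (!x' && !y' || x && y').toNat) (by decide +kernel)

end Functigraph

/-! ### The classification -/

open Functigraph SimpleGraph in
theorem mainTheorem8 (k : ℕ) (hk : 3 ≤ k) (f : Fin (3 * k) → Fin (3 * k))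
    (hf : Functigraph.IsThreeTranslate k f) (hnp : ¬ Function.Bijective f) :
    2 * Functigraph.dominationNumber (SimpleGraph.cycleGraph (3 * k)) = 2 * k ∧
    (Functigraph.dominationNumber
        (Functigraph.functigraph (SimpleGraph.cycleGraph (3 * k)) f) = 2 * k ↔
      (Nonempty (Functigraph.functigraph (SimpleGraph.cycleGraph (3 * k)) f ≃g
          Functigraph.functigraph (SimpleGraph.cycleGraph (3 * k))
            (Functigraph.threeTranslate k ![0, 0, 1])) ∨
        Nonempty (Functigraph.functigraph (SimpleGraph.cycleGraph (3 * k)) f ≃g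
          Functigraph.functigraph (SimpleGraph.cycleGraph (3 * k))
            (Functigraph.threeTranslate k ![0, 1, 0])) ∨
        Nonempty (Functigraph.functigraph (SimpleGraph.cycleGraph (3 * k)) f ≃g
          Functigraph.functigraph (SimpleGraph.cycleGraph (3 * k))
            (Functigraph.threeTranslate k ![0, 2, 0])))) := by
  have hk1 : 1 ≤ k := by omega
  refine ⟨by rw [dominationNumber_cycleGraph hk1], ?_, ?_⟩
  · intro hγ
    obtain ⟨a, rfl⟩ := hf.exists_eq hk1
    have ha : ¬ Function.Injective a := fun h => hnp (threeTranslate_bijective h)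
    obtain ⟨r, s, t, rfl⟩ : ∃ r s t, a = ![r, s, t] :=
      ⟨a 0, a 1, a 2, by ext i; fin_cases i <;> rfl⟩
    -- The 27 words appear in lexicographic order; the six injective ones contradict `ha`.
    fin_cases r <;> fin_cases s <;> fin_cases t
    · exact absurd hγ (dominationNumber_000_lt hk).ne
    · exact Or.inl ⟨Iso.refl⟩
    · exact Or.inl (nonempty_iso_002 hk)
    · exact Or.inr (Or.inl ⟨Iso.refl⟩)
    · exact Or.inl (nonempty_iso_011 hk)
    · exact absurd (by decide) ha
    · exact Or.inr (Or.inr ⟨Iso.refl⟩)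
    · exact absurd (by decide) ha
    · exact Or.inl (nonempty_iso_022 hk)
    · exact absurd hγ (dominationNumber_100_lt hk).ne
    · exact Or.inr (Or.inl (nonempty_iso_101 hk))
    · exact absurd (by decide) ha
    · exact absurd hγ (dominationNumber_110_lt hk).ne
    · exact absurd hγ (dominationNumber_111_lt hk).ne
    · exact Or.inl (nonempty_iso_112 hk)
    · exact absurd (by decide) ha
    · exact Or.inr (Or.inl (nonempty_iso_121 hk))
    · exact Or.inl (nonempty_iso_122 hk)
    · exact absurd hγ (dominationNumber_200_lt hk).ne
    · exact absurd (by decide) ha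
    · exact Or.inr (Or.inr (nonempty_iso_202 hk))
    · exact absurd (by decide) ha
    · exact absurd hγ (dominationNumber_211_lt hk).ne
    · exact Or.inr (Or.inl (nonempty_iso_212 hk))
    · exact absurd hγ (dominationNumber_220_lt hk).ne
    · exact absurd hγ (dominationNumber_221_lt hk).ne
    · exact absurd hγ (dominationNumber_222_lt hk).ne
  · rintro (⟨⟨e⟩⟩ | ⟨⟨e⟩⟩ | ⟨⟨e⟩⟩)
    · exact (dominationNumber_congr e).trans (dominationNumber_001 hk)
    · exact (dominationNumber_congr e).trans (dominationNumber_010 hk)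
    · exact (dominationNumber_congr e).trans (dominationNumber_020 hk)
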